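/- There are real constants $\gamma_{m,n}$, depending only on the positive integers $m$ and $n$, with the following property. Let $P_{\mathbf A}(z)=Iz^m+A_{m-1}z^{m-1}+\cdots+A_1z+A_0$ and $P_{\bar{\mathbf A}}(z)=Iz^m+\bar A_{m-1}z^{m-1}+\cdots+\bar A_1z+\bar A_0$ be monic matrix polynomials with coefficients in $\mathbb C^{n\times n}$, and assume that the $mn\times mn$ companion matrix $$C_{\mathbf A}=\begin{bmatrix}0&I&0&\cdots&0\\0&0&I&\cdots&0\\\vdots&\vdots&\vdots&&\vdots\\0&0&0&\cdots&I\\-A_0&-A_1&-A_2&\cdots&-A_{m-1}\end{bmatrix}$$ is Hermitian. Then for every $p$ with $1\le p\le\infty$, $$\operatorname{dist}(\sigma(\mathbf A),\sigma(\bar{\mathbf A}))\le(\gamma_{m,n}+2)\,\|\mathbf A-\bar{\mathbf A}\|_p\le(\gamma_{m,n}+2)\sum_{i=0}^{m-1}\|A_i-\bar A_i\|_p .$$ Here $\sigma(\mathbf A)=\{\lambda_1,\dots,\lambda_{mn}\}$ and $\sigma(\bar{\mathbf A})=\{\bar\lambda_1,\dots,\bar\lambda_{mn}\}$ are the zeros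 of $\det P_{\mathbf A}(z)$ and $\det P_{\bar{\mathbf A}}(z)$, repeated according to multiplicity, and $\operatorname{dist}(\sigma(\mathbf A),\sigma(\bar{\mathbf A}))=\min_\theta\max_j|\lambda_j-\bar\lambda_{\theta(j)}|$, the minimum being over all permutations $\theta$ of $\{1,\dots,mn\}$, is their optimal matching distance. For a complex matrix $M$, $\|M\|_p=\max\{|Mx|_p:|x|_p=1\}$ is the operator norm induced by the vector $p$-norms, and $\|\mathbf A-\bar{\mathbf A}\|_p$ is the operator $p$-norm of the tuple $\mathbf A-\bar{\mathbf A}=(A_0-\bar A_0,\dots,A_{m-1}-\bar A_{m-1},0)$ (the leading coefficients are $I$ in both), regarded as a block row. -/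

import Mathlib

open scoped ENNReal Matrix Polynomial

noncomputable section

namespace MatPoly

/-- The operator `p`-norm of a (possibly rectangular) complex matrix, `1 ≤ p ≤ ∞`, i.e. the operator
norm of `x ↦ M x` when both spaces carry the vector `p`-norm. -/
def opNorm {ι κ : Type*} [Fintype ι] [Fintype κ] [DecidableEq κ] (p : ℝ≥0∞) [Fact (1 ≤ p)]
    (M : Matrix ι κ ℂ) : ℝ :=
  ‖LinearMap.toContinuousLinearMap (Matrix.toLpLin p p M)‖

/-- The operator `p`-norm is `max {|M x|_p : |x|_p = 1}`. -/
theorem opNorm_isGreatest {ι κ : Type*} [Fintype ι] [Fintype κ] [DecidableEq κ] [Nonempty κ]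
    (p : ℝ≥0∞) [Fact (1 ≤ p)] (M : Matrix ι κ ℂ) :
    IsGreatest {r : ℝ | ∃ x : κ → ℂ, ‖WithLp.toLp p x‖ = 1 ∧ ‖WithLp.toLp p (M *ᵥ x)‖ = r}
      (opNorm p M) := by
  have hset : {r : ℝ | ∃ x : κ → ℂ, ‖WithLp.toLp p x‖ = 1 ∧ ‖WithLp.toLp p (M *ᵥ x)‖ = r} =
      (fun x => ‖LinearMap.toContinuousLinearMap (Matrix.toLpLin p p M) x‖) ''
        Metric.sphere (0 : WithLp p (κ → ℂ)) 1 := by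
    ext r
    constructor
    · rintro ⟨x, hx, hr⟩
      exact ⟨WithLp.toLp p x, by simpa using hx, hr⟩
    · rintro ⟨x, hx, hr⟩
      exact ⟨WithLp.ofLp x, by simpa using hx, hr⟩
  rw [hset, opNorm, ← ContinuousLinearMap.sSup_sphere_eq_norm]
  have : ProperSpace (WithLp p (κ → ℂ)) := FiniteDimensional.proper ℂ _
  refine IsCompact.isGreatest_sSup ((isCompact_sphere _ _).image ?_) ?_
  · exact (ContinuousLinearMap.continuous _).norm
  · obtain ⟨x, hx⟩ := exists_norm_eq (WithLp p (κ → ℂ)) zero_le_one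
    exact ⟨_, x, by simpa using hx, rfl⟩

/-- The matrix polynomial `A₀ + A₁ z + ⋯ + A_{k-1} z^{k-1}` associated to a `k`-tuple of matrices. -/
def matPoly {k n : ℕ} (A : Fin k → Matrix (Fin n) (Fin n) ℂ) : Matrix (Fin n) (Fin n) ℂ[X] :=
  ∑ i : Fin k, (Polynomial.X ^ (i : ℕ) : ℂ[X]) • (A i).map Polynomial.C

/-- The `(m+1)`-tuple `(A₀, …, A_{m-1}, I)`. -/
def monicTuple {m n : ℕ} (A : Fin m → Matrix (Fin n) (Fin n) ℂ) :
    Fin (m + 1) → Matrix (Fin n) (Fin n) ℂ :=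
  Fin.snoc (α := fun _ => Matrix (Fin n) (Fin n) ℂ) A 1

/-- The eigenvalues of the monic matrix polynomial `P_A(z) = I z^m + A_{m-1} z^{m-1} + ⋯ + A₀`, each
repeated according to its multiplicity as a zero of `det P_A(z)`. -/
def spec {m n : ℕ} (A : Fin m → Matrix (Fin n) (Fin n) ℂ) : Multiset ℂ :=
  (matPoly (monicTuple A)).det.roots

theorem matPoly_apply {k n : ℕ} (A : Fin k → Matrix (Fin n) (Fin n) ℂ) (a b : Fin n) :
    matPoly A a b = ∑ i : Fin k, Polynomial.C (A i a b) * Polynomial.X ^ (i : ℕ) := by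
  rw [matPoly, Matrix.sum_apply]
  refine Finset.sum_congr rfl fun i _ => ?_
  rw [Matrix.smul_apply, Matrix.map_apply, smul_eq_mul, mul_comm]

theorem natDegree_matPoly_le {m n : ℕ} (A : Fin (m + 1) → Matrix (Fin n) (Fin n) ℂ)
    (a b : Fin n) : (matPoly A a b).natDegree ≤ m := by
  rw [matPoly_apply]
  refine Polynomial.natDegree_sum_le_of_forall_le _ _ fun i _ => ?_
  exact (Polynomial.natDegree_C_mul_X_pow_le _ _).trans (Nat.lt_succ_iff.1 i.2)

theorem coeff_matPoly {m n : ℕ} (A : Fin (m + 1) → Matrix (Fin n) (Fin n) ℂ) (a b : Fin n) :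
    (matPoly A a b).coeff m = A (Fin.last m) a b := by
  rw [matPoly_apply, Polynomial.finsetSum_coeff, Finset.sum_eq_single (Fin.last m)]
  · simp
  · intro i _ hi
    rw [Polynomial.coeff_C_mul_X_pow, if_neg]
    exact fun h => hi (Fin.ext h.symm)
  · simp

/-- A monic matrix polynomial of degree `m` and size `n` has exactly `m * n` eigenvalues. -/
theorem card_spec {m n : ℕ} (A : Fin m → Matrix (Fin n) (Fin n) ℂ) :
    Multiset.card (spec A) = m * n := by
  have hle : (matPoly (monicTuple A)).det.natDegree ≤ n * m := by
    rw [Matrix.det_apply]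
    refine Polynomial.natDegree_sum_le_of_forall_le _ _ fun s _ => ?_
    refine (Polynomial.natDegree_smul_le _ _).trans ((Polynomial.natDegree_prod_le _ _).trans ?_)
    exact (Finset.sum_le_card_nsmul _ _ m fun i _ => natDegree_matPoly_le _ _ _).trans (by simp)
  have hco : (matPoly (monicTuple A)).det.coeff (n * m) = 1 := by
    have h1 : (monicTuple A (Fin.last m)).det = 1 := by simp [monicTuple]
    rw [← h1, Matrix.det_apply, Matrix.det_apply, Polynomial.finsetSum_coeff]
    refine Finset.sum_congr rfl fun s _ => ?_
    rw [Polynomial.coeff_smul]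
    congr 1
    have h2 := Polynomial.coeff_prod_of_natDegree_le (Finset.univ)
      (fun i => matPoly (monicTuple A) (s i) i) m fun i _ => natDegree_matPoly_le _ _ _
    rw [Finset.card_univ, Fintype.card_fin] at h2
    rw [h2]
    exact Finset.prod_congr rfl fun i _ => coeff_matPoly _ _ _
  rw [spec, ← (IsAlgClosed.splits _).natDegree_eq_card_roots, mul_comm]
  exact le_antisymm hle (Polynomial.le_natDegree_of_ne_zero (by rw [hco]; exact one_ne_zero))

/-- An enumeration `λ_1, …, λ_{mn}` of the eigenvalues of `P_A(z)`, with multiplicity (which one is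
immaterial below, where all permutations are considered). -/
def eigs {m n : ℕ} (A : Fin m → Matrix (Fin n) (Fin n) ℂ) (j : Fin (m * n)) : ℂ :=
  (spec A).toList.get (j.cast (by rw [Multiset.length_toList, card_spec]))

theorem map_eigs {m n : ℕ} (A : Fin m → Matrix (Fin n) (Fin n) ℂ) :
    Finset.univ.val.map (eigs A) = spec A := by
  have h : (spec A).toList.length = m * n := by rw [Multiset.length_toList, card_spec]
  have h2 : List.ofFn (eigs A) = (spec A).toList := by
    refine List.ext_get (by simp [h]) fun i h1 h2 => ?_
    simp [eigs]
  rw [← Multiset.coe_toList (spec A), ← h2, Fin.univ_val_map]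

/-- The optimal matching distance `min_θ max_j |α_j - β_{θ(j)}|`, with `θ` running over all
permutations of the index set. -/
def matchingDist {N : ℕ} (α β : Fin N → ℂ) : ℝ :=
  ⨅ θ : Equiv.Perm (Fin N), ⨆ j : Fin N, ‖α j - β (θ j)‖

/-- The optimal matching distance `dist(σ(A), σ(B))` between the spectra of the monic matrix
polynomials `P_A(z)` and `P_B(z)`. -/
def specDist {m n : ℕ} (A B : Fin m → Matrix (Fin n) (Fin n) ℂ) : ℝ :=
  matchingDist (eigs A) (eigs B)

/-- The `mn × mn` companion matrix of `P_A(z) = I z^m + A_{m-1} z^{m-1} + ⋯ + A₀`: the identity in the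
blocks `(i, i+1)`, last block row `(-A₀, …, -A_{m-1})`, zero elsewhere. -/
def companion {m n : ℕ} (A : Fin m → Matrix (Fin n) (Fin n) ℂ) :
    Matrix (Fin m × Fin n) (Fin m × Fin n) ℂ :=
  Matrix.of fun r c =>
    if (r.1 : ℕ) + 1 = m then -(A c.1 r.2 c.2)
    else if (c.1 : ℕ) = (r.1 : ℕ) + 1 ∧ r.2 = c.2 then 1 else 0

/-- The operator `p`-norm of a `k`-tuple of `n × n` matrices: that of the `n × kn` block row
`[A₀, A₁, …, A_{k-1}]`. -/
def tupleNorm {k n : ℕ} (p : ℝ≥0∞) [Fact (1 ≤ p)] (A : Fin k → Matrix (Fin n) (Fin n) ℂ) : ℝ :=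
  opNorm p (Matrix.of fun (a : Fin n) (c : Fin k × Fin n) => A c.1 a c.2)

end MatPoly

end

/-! The eigenvalues of a monic matrix polynomial are those of its companion matrix
(`roots_charpoly_companion`), so the claim concerns a Hermitian `H` and an arbitrary perturbation
`T` of size `N = mn`. By Schur, `T` is upper triangular in an orthonormal basis, with its
eigenvalues `τ i` on the diagonal. In that basis `H` is within `ε` entrywise of the diagonal matrix
of the `(τ i).re`: below the diagonal because `T` vanishes there, above it by Hermitian symmetry.
Weyl's inequality matches the sorted eigenvalues of `H` with the sorted real parts up to `N * ε`,
and the imaginary parts are at most `ε` since `H` has a real diagonal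
(`exists_matching_of_isSymmetric`). The entries of the perturbation are bounded by the tuple norm
for every `p` (`norm_companion_sub_le`), so crude comparison of norms gives a constant depending on
`N` alone. -/

namespace MatPoly


/-! ### Schur triangularization, Weyl's inequality, matching of multisets -/

open Module in
/-- **Schur triangularization**: every endomorphism of a finite-dimensional complex inner product
space is upper triangular in some orthonormal basis. -/
theorem exists_orthonormalBasis_upperTriangular (n : ℕ) :
    ∀ {E : Type*} [NormedAddCommGroup E] [InnerProductSpace ℂ E] [FiniteDimensional ℂ E]
      (_ : finrank ℂ E = n) (T : E →ₗ[ℂ] E),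
      ∃ b : OrthonormalBasis (Fin n) ℂ E, ∀ i j, j < i → inner ℂ (b i) (T (b j)) = 0 := by
  induction n with
  | zero =>
    intro E _ _ _ hE T
    exact ⟨(stdOrthonormalBasis ℂ E).reindex (finCongr hE), fun i => i.elim0⟩
  | succ n ih =>
    intro E _ _ _ hE T
    have : Nontrivial E := nontrivial_of_finrank_pos (R := ℂ) (by omega)
    -- An eigenvector of the adjoint has a `T`-invariant orthogonal complement; placed last in the
    -- basis, it keeps `T` upper triangular.
    obtain ⟨μ, hμ⟩ := Module.End.exists_eigenvalue (LinearMap.adjoint T)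
    obtain ⟨w, hw⟩ := hμ.exists_hasEigenvector
    have hw0 : w ≠ 0 := hw.2
    set v : E := ((‖w‖ : ℂ)⁻¹) • w with hv
    have hv1 : ‖v‖ = 1 := by
      rw [hv, norm_smul, norm_inv, Complex.norm_real, norm_norm,
        inv_mul_cancel₀ (norm_ne_zero_iff.2 hw0)]
    have hTv : LinearMap.adjoint T v = μ • v := by
      rw [hv, map_smul, hw.apply_eq_smul, smul_comm]
    let W : Submodule ℂ E := (ℂ ∙ v)ᗮ
    have hmem : ∀ x : E, x ∈ W ↔ inner ℂ v x = 0 := fun x =>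
      Submodule.mem_orthogonal_singleton_iff_inner_right
    have hWT : ∀ x ∈ W, T x ∈ W := by
      intro x hx
      rw [hmem] at hx ⊢
      rw [← LinearMap.adjoint_inner_left, hTv, inner_smul_left, hx, mul_zero]
    have hWdim : finrank ℂ W = n := by
      have := Fact.mk hE
      exact Submodule.finrank_orthogonal_span_singleton
        (by rintro h; simp [h] at hv1)
    obtain ⟨c, hc⟩ := ih hWdim (T.restrict hWT)
    let f : Fin (n + 1) → E := Fin.snoc (α := fun _ => E) (fun i => (c i : E)) v
    have hf1 : ∀ i : Fin n, f i.castSucc = c i := fun i => by simp [f]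
    have hf2 : f (Fin.last n) = v := by simp [f]
    have hvc : ∀ i, inner ℂ v (c i : E) = 0 := fun i => (hmem _).1 (c i).2
    have hcv : ∀ i, inner ℂ (c i : E) v = 0 := fun i => by
      rw [← inner_conj_symm, hvc, map_zero]
    have hon : Orthonormal ℂ f := by
      rw [orthonormal_iff_ite]
      intro i j
      induction i using Fin.lastCases with
      | last =>
        induction j using Fin.lastCases with
        | last => simp [hf2, hv1, inner_self_eq_norm_sq_to_K]
        | cast j => rw [hf1, hf2, hvc, if_neg (Fin.castSucc_lt_last j).ne']
      | cast i =>
        induction j using Fin.lastCases with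
        | last => rw [hf1, hf2, hcv, if_neg (Fin.castSucc_lt_last i).ne]
        | cast j =>
          rw [hf1, hf1, ← Submodule.coe_inner, orthonormal_iff_ite.1 c.orthonormal]
          simp
    let B := basisOfOrthonormalOfCardEqFinrank hon (by simp [hE])
    have hB : (B : Fin (n + 1) → E) = f := coe_basisOfOrthonormalOfCardEqFinrank hon _
    refine ⟨B.toOrthonormalBasis (by rw [hB]; exact hon), fun i j hij => ?_⟩
    rw [Module.Basis.coe_toOrthonormalBasis, hB]
    have hj : j ≠ Fin.last n := (hij.trans_le (Fin.le_last i)).ne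
    induction j using Fin.lastCases with
    | last => exact absurd rfl hj
    | cast j =>
      rw [hf1]
      induction i using Fin.lastCases with
      | last =>
        rw [hf2]
        exact (hmem _).1 (hWT _ (c j).2)
      | cast i =>
        rw [hf1]
        exact hc i j (by simpa using hij)

/-- **Weyl's inequality** for quadratic forms that are diagonal in orthonormal bases, with the
coefficients in decreasing order. -/
theorem weyl_inequality {n : ℕ} {E : Type*} [NormedAddCommGroup E] [InnerProductSpace ℂ E]
    (u v : OrthonormalBasis (Fin n) ℂ E) {a c : Fin n → ℝ} (ha : Antitone a) (hc : Antitone c)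
    {ε : ℝ}
    (h : ∀ x, ∑ i, a i * ‖inner ℂ (u i) x‖ ^ 2 ≤ ∑ i, c i * ‖inner ℂ (v i) x‖ ^ 2 + ε * ‖x‖ ^ 2)
    (k : Fin n) : a k ≤ c k + ε := by
  have : FiniteDimensional ℂ E := u.toBasis.finiteDimensional_of_finite
  -- Only `n - 1` orthogonality conditions, so some `x ≠ 0` meets them all. On this `x` the first
  -- form is at least `a k * ‖x‖ ^ 2` and the second at most `c k * ‖x‖ ^ 2`.
  let w : {i : Fin n // i ≠ k} → E := fun i => if k < i then u i else v i
  let F : E →ₗ[ℂ] ({i : Fin n // i ≠ k} → ℂ) := LinearMap.pi fun i => (innerₛₗ ℂ (w i))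
  have hF : LinearMap.ker F ≠ ⊥ := by
    apply LinearMap.ker_ne_bot_of_finrank_lt
    have h1 : Module.finrank ℂ E = n := by
      rw [Module.finrank_eq_card_basis u.toBasis, Fintype.card_fin]
    have := k.pos
    rw [h1, Module.finrank_fintype_fun_eq_card, Fintype.card_subtype_compl, Fintype.card_fin,
      Fintype.card_subtype_eq]
    omega
  obtain ⟨x, hx, hx0⟩ := Submodule.exists_mem_ne_zero_of_ne_bot hF
  have hw : ∀ i : Fin n, ∀ hi : i ≠ k, inner ℂ (if k < i then u i else v i) x = 0 := fun i hi =>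
    congrFun (LinearMap.mem_ker.1 hx) ⟨i, hi⟩
  have hu : a k * ‖x‖ ^ 2 ≤ ∑ i, a i * ‖inner ℂ (u i) x‖ ^ 2 := by
    rw [← u.sum_sq_norm_inner_right x, Finset.mul_sum]
    refine Finset.sum_le_sum fun i _ => ?_
    rcases le_or_gt i k with hik | hik
    · exact mul_le_mul_of_nonneg_right (ha hik) (by positivity)
    · have := hw i hik.ne'
      rw [if_pos hik] at this
      simp [this]
  have hv : ∑ i, c i * ‖inner ℂ (v i) x‖ ^ 2 ≤ c k * ‖x‖ ^ 2 := by
    rw [← v.sum_sq_norm_inner_right x, Finset.mul_sum]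
    refine Finset.sum_le_sum fun i _ => ?_
    rcases le_or_gt k i with hik | hik
    · exact mul_le_mul_of_nonneg_right (hc hik) (by positivity)
    · have := hw i hik.ne
      rw [if_neg hik.not_gt] at this
      simp [this]
  have hpos : 0 < ‖x‖ ^ 2 := by positivity
  have := h x
  exact le_of_mul_le_mul_right (by linarith) hpos

/-- Two families with the same multiset of values differ by a permutation of the index set. -/
theorem exists_perm_of_map_univ_eq {ι α : Type*} [Fintype ι] {f g : ι → α}
    (h : Finset.univ.val.map f = Finset.univ.val.map g) : ∃ σ : Equiv.Perm ι, ∀ i, g (σ i) = f i := by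
  classical
  have hcard : ∀ c, Fintype.card {i // f i = c} = Fintype.card {i // g i = c} := by
    intro c
    have := congrArg (Multiset.count c) h
    rw [Multiset.count_map, Multiset.count_map] at this
    rw [Fintype.card_subtype, Fintype.card_subtype]
    simpa [Finset.card, Finset.filter_val, eq_comm] using this
  exact ⟨Equiv.ofFiberEquiv fun c => Fintype.equivOfCardEq (hcard c),
    fun i => Equiv.ofFiberEquiv_map _ i⟩


/-! ### Perturbation of a Hermitian operator -/

/-- If all entries of a complex matrix are at most `ε` in modulus, its sesquilinear form is bounded
by `n * ε`. -/
theorem norm_sum_sum_le {n : ℕ} (M : Fin n → Fin n → ℂ) {ε : ℝ} (hM : ∀ i j, ‖M i j‖ ≤ ε)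
    (ξ : Fin n → ℂ) :
    ‖∑ i, ∑ j, starRingEnd ℂ (ξ i) * (ξ j * M i j)‖ ≤ n * ε * ∑ i, ‖ξ i‖ ^ 2 := by
  rcases Nat.eq_zero_or_pos n with rfl | hn
  · simp
  have hε : 0 ≤ ε := (norm_nonneg _).trans (hM ⟨0, hn⟩ ⟨0, hn⟩)
  have h1 : (∑ i, ‖ξ i‖) ^ 2 ≤ n * ∑ i, ‖ξ i‖ ^ 2 := by
    simpa using sq_sum_le_card_mul_sum_sq (s := Finset.univ) (f := fun i => ‖ξ i‖)
  calc ‖∑ i, ∑ j, starRingEnd ℂ (ξ i) * (ξ j * M i j)‖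
      ≤ ∑ i, ∑ j, ‖ξ i‖ * (‖ξ j‖ * ε) := by
        refine norm_sum_le_of_le _ fun i _ => norm_sum_le_of_le _ fun j _ => ?_
        rw [norm_mul, norm_mul, RCLike.norm_conj]
        gcongr
        exact hM i j
    _ = ε * (∑ i, ‖ξ i‖) ^ 2 := by
        rw [sq, Finset.sum_mul_sum, Finset.mul_sum]
        refine Finset.sum_congr rfl fun i _ => ?_
        rw [Finset.mul_sum]
        exact Finset.sum_congr rfl fun j _ => by ring
    _ ≤ ε * (n * ∑ i, ‖ξ i‖ ^ 2) := by gcongr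
    _ = n * ε * ∑ i, ‖ξ i‖ ^ 2 := by ring

section

variable {n : ℕ} {E : Type*} [NormedAddCommGroup E] [InnerProductSpace ℂ E]

theorem re_inner_apply_self_of_eigenbasis {H : E →ₗ[ℂ] E} (hH : H.IsSymmetric)
    (u : OrthonormalBasis (Fin n) ℂ E) (a : Fin n → ℝ) (hu : ∀ i, H (u i) = (a i : ℂ) • u i) (x : E) :
    (inner ℂ x (H x)).re = ∑ i, a i * ‖inner ℂ (u i) x‖ ^ 2 := by
  rw [← u.sum_inner_mul_inner x (H x), Complex.re_sum]
  refine Finset.sum_congr rfl fun i _ => ?_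
  rw [← hH, hu, inner_smul_left, Complex.conj_ofReal, ← inner_conj_symm x (u i), mul_left_comm,
    Complex.conj_mul', ← Complex.ofReal_pow, ← Complex.ofReal_mul, Complex.ofReal_re]

theorem inner_apply_eq_sum_sum (b : OrthonormalBasis (Fin n) ℂ E) (H : E →ₗ[ℂ] E) (x : E) :
    inner ℂ x (H x) = ∑ i, ∑ j, starRingEnd ℂ (inner ℂ (b i) x) *
      (inner ℂ (b j) x * inner ℂ (b i) (H (b j))) := by
  rw [← b.sum_inner_mul_inner x (H x)]
  refine Finset.sum_congr rfl fun i _ => ?_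
  rw [inner_conj_symm, ← Finset.mul_sum]
  congr 1
  conv_lhs => rw [← b.sum_repr' x, map_sum, inner_sum]
  exact Finset.sum_congr rfl fun j _ => by rw [map_smul, inner_smul_right]

theorem roots_charpoly_of_upperTriangular [FiniteDimensional ℂ E] (T : E →ₗ[ℂ] E)
    (b : OrthonormalBasis (Fin n) ℂ E) (hb : ∀ i j, j < i → inner ℂ (b i) (T (b j)) = 0) :
    T.charpoly.roots = Finset.univ.val.map fun i => inner ℂ (b i) (T (b i)) := by
  have hentry : ∀ i j, LinearMap.toMatrix b.toBasis b.toBasis T i j = inner ℂ (b i) (T (b j)) := by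
    intro i j
    rw [LinearMap.toMatrix_apply, OrthonormalBasis.coe_toBasis_repr_apply,
      OrthonormalBasis.repr_apply_apply, OrthonormalBasis.coe_toBasis]
  have hup : (LinearMap.toMatrix b.toBasis b.toBasis T).IsUpperTriangular := by
    intro i j hij
    rw [hentry]
    exact hb i j hij
  rw [← LinearMap.charpoly_toMatrix T b.toBasis, Matrix.charpoly_of_isUpperTriangular _ hup]
  simp only [hentry]
  rw [Finset.prod_eq_multiset_prod, Polynomial.roots_multiset_prod, Multiset.bind_map]
  · simp [Multiset.bind_singleton]
  · simp [Polynomial.X_sub_C_ne_zero]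

/-- The eigenvalues of a Hermitian operator and those of an arbitrary perturbation of it can be
matched up to `(n + 1)` times the size of the perturbation. -/
theorem exists_matching_of_isSymmetric [FiniteDimensional ℂ E] (hn : Module.finrank ℂ E = n)
    {H : E →ₗ[ℂ] E} (hH : H.IsSymmetric) (T : E →ₗ[ℂ] E) {ε : ℝ}
    (hε : ∀ x y, ‖x‖ = 1 → ‖y‖ = 1 → ‖inner ℂ x ((T - H) y)‖ ≤ ε) :
    ∃ a t : Fin n → ℂ, H.charpoly.roots = Finset.univ.val.map a ∧
      T.charpoly.roots = Finset.univ.val.map t ∧ ∀ i, ‖a i - t i‖ ≤ (n + 1) * ε := by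
  obtain ⟨b, hb⟩ := exists_orthonormalBasis_upperTriangular n hn T
  set τ : Fin n → ℂ := fun i => inner ℂ (b i) (T (b i)) with hτ
  have he : ∀ i j, ‖inner ℂ (b i) (T (b j)) - inner ℂ (b i) (H (b j))‖ ≤ ε := by
    intro i j
    rw [← inner_sub_right, ← LinearMap.sub_apply]
    exact hε _ _ (b.norm_eq_one i) (b.norm_eq_one j)
  have hconj : ∀ i j, starRingEnd ℂ (inner ℂ (b i) (H (b j))) = inner ℂ (b j) (H (b i)) := by
    intro i j
    rw [inner_conj_symm, hH]
  have hreal : ∀ i, ((inner ℂ (b i) (H (b i)) : ℂ)).im = 0 := fun i =>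
    Complex.conj_eq_iff_im.1 (hconj i i)
  have him : ∀ i, |(τ i).im| ≤ ε := by
    intro i
    have := (Complex.abs_im_le_norm _).trans (he i i)
    rwa [Complex.sub_im, hreal, sub_zero] at this
  -- Above the diagonal, conjugation moves the entry of `H` below it, where `T` vanishes; on the
  -- diagonal, real parts are compared.
  have hM : ∀ i j, ‖(inner ℂ (b i) (H (b j)) : ℂ) - (if i = j then ((τ i).re : ℂ) else 0)‖ ≤ ε := by
    intro i j
    rcases lt_trichotomy i j with hij | rfl | hij
    · rw [if_neg hij.ne, sub_zero, ← RCLike.norm_conj, hconj]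
      simpa [hb j i hij] using he j i
    · rw [if_pos rfl]
      have h1 : (inner ℂ (b i) (H (b i)) : ℂ) = ((inner ℂ (b i) (H (b i)) : ℂ).re : ℂ) :=
        Complex.ext (by simp) (by simp [hreal])
      rw [h1, ← Complex.ofReal_sub, Complex.norm_real, Real.norm_eq_abs, abs_sub_comm]
      have := (Complex.abs_re_le_norm _).trans (he i i)
      rwa [Complex.sub_re] at this
    · rw [if_neg hij.ne', sub_zero]
      simpa [hb i j hij] using he i j
  have hform : ∀ x, |(inner ℂ x (H x)).re - ∑ i, (τ i).re * ‖inner ℂ (b i) x‖ ^ 2| ≤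
      n * ε * ‖x‖ ^ 2 := by
    intro x
    have h1 := norm_sum_sum_le _ hM fun i => inner ℂ (b i) x
    rw [b.sum_sq_norm_inner_right] at h1
    refine le_trans (le_of_eq_of_le ?_ (Complex.abs_re_le_norm _)) h1
    congr 1
    simp only [mul_sub, Finset.sum_sub_distrib, ← inner_apply_eq_sum_sum, Complex.sub_re]
    congr 1
    rw [Complex.re_sum]
    refine Finset.sum_congr rfl fun i _ => ?_
    simp only [mul_ite, mul_zero, Finset.sum_ite_eq, Finset.mem_univ, if_true]
    rw [← mul_assoc, Complex.conj_mul', ← Complex.ofReal_pow, ← Complex.ofReal_mul,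
      Complex.ofReal_re, mul_comm]
  -- The sign turns the increasing sort into a decreasing one, the order of `hH.eigenvalues`.
  set σ : Equiv.Perm (Fin n) := Tuple.sort fun i => -(τ i).re with hσ
  have hanti : Antitone fun i => (τ (σ i)).re := by
    intro i j hij
    have := Tuple.monotone_sort (fun i => -(τ i).re) hij
    simpa using this
  have hsum : ∀ x, ∑ i, (τ (σ i)).re * ‖inner ℂ (b.reindex σ.symm i) x‖ ^ 2 =
      ∑ i, (τ i).re * ‖inner ℂ (b i) x‖ ^ 2 := by
    intro x
    simp only [OrthonormalBasis.reindex_apply, Equiv.symm_symm]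
    exact Equiv.sum_comp σ fun i => (τ i).re * ‖inner ℂ (b i) x‖ ^ 2
  have hre := re_inner_apply_self_of_eigenbasis hH (hH.eigenvectorBasis hn) (hH.eigenvalues hn)
    (hH.apply_eigenvectorBasis hn)
  have hle : ∀ k, hH.eigenvalues hn k ≤ (τ (σ k)).re + n * ε := by
    refine weyl_inequality (hH.eigenvectorBasis hn) (b.reindex σ.symm)
      (hH.eigenvalues_antitone hn) hanti fun x => ?_
    have := (abs_le.1 (hform x)).2
    rw [hre] at this
    rw [hsum]
    linarith
  have hge : ∀ k, (τ (σ k)).re ≤ hH.eigenvalues hn k + n * ε := by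
    refine weyl_inequality (b.reindex σ.symm) (hH.eigenvectorBasis hn) hanti
      (hH.eigenvalues_antitone hn) fun x => ?_
    have := (abs_le.1 (hform x)).1
    rw [hre] at this
    rw [hsum]
    linarith
  refine ⟨fun i => (hH.eigenvalues hn i : ℂ), fun i => τ (σ i),
    hH.roots_charpoly_eq_eigenvalues hn, ?_, fun i => ?_⟩
  · conv_lhs => rw [roots_charpoly_of_upperTriangular T b hb, ← Multiset.map_univ_val_equiv σ,
      Multiset.map_map]
    rfl
  · refine (Complex.norm_le_abs_re_add_abs_im _).trans ?_
    have h1 : |hH.eigenvalues hn i - (τ (σ i)).re| ≤ n * ε :=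
      abs_le.2 ⟨by linarith [hge i], by linarith [hle i]⟩
    have h2 := him (σ i)
    simp only [Complex.sub_re, Complex.sub_im, Complex.ofReal_re, Complex.ofReal_im, zero_sub,
      abs_neg]
    linarith

end


/-! ### Linearization by the companion matrix -/

/-- The block unipotent matrix with block `z ^ (i - j)` in position `(i, j)`, `j ≤ i`. -/
noncomputable def powMatrix (m n : ℕ) : Matrix (Fin m × Fin n) (Fin m × Fin n) ℂ[X] :=
  Matrix.of fun r c => if c.1 ≤ r.1 ∧ r.2 = c.2 then Polynomial.X ^ ((r.1 : ℕ) - c.1) else 0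

theorem det_powMatrix (m n : ℕ) : (powMatrix m n).det = 1 := by
  have h : (powMatrix m n).BlockTriangular (fun r => OrderDual.toDual r.1) := by
    intro r c hrc
    have : r.1 < c.1 := hrc
    simp [powMatrix, this.not_ge]
  rw [h.det_fintype]
  refine Finset.prod_eq_one fun k _ => ?_
  suffices h1 : (powMatrix m n).toSquareBlock (fun r => OrderDual.toDual r.1) k = 1 by
    rw [h1, Matrix.det_one]
  ext ⟨⟨i, a⟩, hi⟩ ⟨⟨j, b⟩, hj⟩ : 1
  have hij : i = j := by
    have := hi.trans hj.symm
    exact this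
  subst hij
  by_cases hab : a = b <;> simp [powMatrix, Matrix.toSquareBlock_def, Matrix.one_apply, hab]

/-- The product of `zI - C` with `powMatrix`, in the rows other than the last. -/
theorem charmatrix_mul_powMatrix_apply {m n : ℕ} (A : Fin (m + 1) → Matrix (Fin n) (Fin n) ℂ)
    (i : Fin m) (a : Fin n) (j : Fin (m + 1)) (b : Fin n) :
    ((companion A).charmatrix * powMatrix (m + 1) n) (i.castSucc, a) (j, b) =
      if j = i.succ ∧ a = b then -1 else 0 := by
  have hrow : ∀ x : Fin (m + 1) × Fin n, (companion A).charmatrix (i.castSucc, a) x =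
      (if x = (i.castSucc, a) then Polynomial.X else 0) - (if x = (i.succ, a) then 1 else 0) := by
    rintro ⟨k, c⟩
    rw [Matrix.charmatrix_apply, Matrix.diagonal_apply]
    congr 1
    · simp [eq_comm]
    · have : (i : ℕ) ≠ m := i.2.ne
      simp only [companion, Matrix.of_apply, Fin.val_castSucc, Nat.add_right_cancel_iff, this,
        if_false, Prod.mk.injEq, Fin.ext_iff, Fin.val_succ]
      split_ifs <;> first | (exfalso; omega) | simp
  rw [Matrix.mul_apply]
  simp only [hrow, sub_mul, ite_mul, zero_mul, one_mul, Finset.sum_sub_distrib,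
    Finset.sum_ite_eq', Finset.mem_univ, if_true]
  simp only [powMatrix, Matrix.of_apply, Fin.le_def, Fin.ext_iff, Fin.val_castSucc, Fin.val_succ]
  by_cases hab : (a : ℕ) = b
  -- For `j ≤ i` the two terms `X * X ^ (i - j)` and `X ^ (i + 1 - j)` cancel; for `j = i + 1` only
  -- the second survives.
  · rcases lt_trichotomy (j : ℕ) (i + 1) with h | h | h
    · have h2 : (j : ℕ) ≤ i := by omega
      simp [hab, h2, h.le, h.ne, Nat.succ_sub h2, pow_succ']
    · simp [hab, h]
    · have h2 : ¬ (j : ℕ) ≤ i := by omega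
      simp [hab, h2, h.not_ge, h.ne']
  · simp [hab]

/-- The product of `zI - C` with `powMatrix`, in the last block row and the first block column. -/
theorem charmatrix_mul_powMatrix_last {m n : ℕ} (A : Fin (m + 1) → Matrix (Fin n) (Fin n) ℂ)
    (a b : Fin n) :
    ((companion A).charmatrix * powMatrix (m + 1) n) (Fin.last m, a) (0, b) =
      matPoly (monicTuple A) a b := by
  have hrow : ∀ x : Fin (m + 1) × Fin n, (companion A).charmatrix (Fin.last m, a) x =
      (if x = (Fin.last m, a) then Polynomial.X else 0) + Polynomial.C (A x.1 a x.2) := by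
    rintro ⟨k, c⟩
    rw [Matrix.charmatrix_apply, Matrix.diagonal_apply]
    simp [companion, eq_comm]
  rw [Matrix.mul_apply]
  simp only [hrow, add_mul, ite_mul, zero_mul, Finset.sum_add_distrib,
    Finset.sum_ite_eq', Finset.mem_univ, if_true]
  rw [matPoly_apply, Fin.sum_univ_castSucc, add_comm, Fintype.sum_prod_type]
  congr 1
  · refine Finset.sum_congr rfl fun k _ => ?_
    simp [powMatrix, monicTuple]
  · by_cases hab : a = b
    · simp [powMatrix, monicTuple, hab, pow_succ']
    · simp [powMatrix, monicTuple, hab]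

/-- The eigenvalues of a monic matrix polynomial are those of its companion matrix. -/
theorem roots_charpoly_companion {m n : ℕ} (A : Fin (m + 1) → Matrix (Fin n) (Fin n) ℂ) :
    (companion A).charpoly.roots = spec A := by
  set W := (companion A).charmatrix * powMatrix (m + 1) n with hW
  have hdet : W.det = (companion A).charpoly := by
    rw [hW, Matrix.det_mul, det_powMatrix, mul_one, Matrix.charpoly]
  -- Moving the last block row of `W` to the top makes it block upper triangular, with diagonal
  -- blocks `P_A(z), -I, …, -I`.
  let e : Equiv.Perm (Fin (m + 1) × Fin n) := ((finRotate (m + 1)).symm).prodCongr (Equiv.refl _)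
  have he0 : ∀ a, e (0, a) = (Fin.last m, a) := fun a => by
    refine Prod.ext ?_ rfl
    exact (Equiv.symm_apply_eq _).2 finRotate_last.symm
  have heS : ∀ (i : Fin m) a, e (i.succ, a) = (i.castSucc, a) := fun i a => by
    refine Prod.ext ?_ rfl
    exact (Equiv.symm_apply_eq _).2 (finRotate_of_lt i.2).symm
  have hS : ∀ (i : Fin m) a (x : Fin (m + 1) × Fin n), W.submatrix e id (i.succ, a) x =
      if x.1 = i.succ ∧ a = x.2 then -1 else 0 := fun i a x => by
    rw [Matrix.submatrix_apply, heS, id]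
    exact charmatrix_mul_powMatrix_apply A i a x.1 x.2
  have htri : (W.submatrix e id).BlockTriangular Prod.fst := by
    rintro ⟨i, a⟩ ⟨j, b⟩ hij
    induction i using Fin.cases with
    | zero => exact absurd hij (Fin.not_lt_zero _)
    | succ i =>
      rw [hS, if_neg]
      exact fun h => hij.ne h.1
  have hblock0 : ((W.submatrix e id).toSquareBlock Prod.fst 0).det =
      (matPoly (monicTuple A)).det := by
    let f : Fin n ≃ {x : Fin (m + 1) × Fin n // x.1 = 0} :=
      ⟨fun a => ⟨(0, a), rfl⟩, fun x => x.1.2, fun _ => rfl, fun ⟨⟨_, _⟩, h⟩ => by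
        simp only at h; subst h; rfl⟩
    rw [← Matrix.det_submatrix_equiv_self f]
    congr 1
    ext a b : 2
    rw [← charmatrix_mul_powMatrix_last A a b, ← he0]
    rfl
  have hblockS : ∀ i : Fin m,
      IsUnit ((W.submatrix e id).toSquareBlock Prod.fst i.succ).det := by
    intro i
    have : (W.submatrix e id).toSquareBlock Prod.fst i.succ = -1 := by
      ext ⟨⟨i', a⟩, hi⟩ ⟨⟨j, b⟩, hj⟩ : 1
      simp only at hi hj
      subst hi hj
      rw [Matrix.toSquareBlock_def, Matrix.of_apply, hS, Matrix.neg_apply, Matrix.one_apply]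
      by_cases hab : a = b <;> simp [hab]
    rw [this, Matrix.det_neg, Matrix.det_one, mul_one]
    exact isUnit_one.neg.pow _
  have h1 := htri.det_fintype
  rw [Fin.prod_univ_succ, hblock0, Matrix.det_permute, hdet] at h1
  -- The signs of the row permutation and of the blocks `-I` are units, which do not affect roots.
  have h2 : Associated (companion A).charpoly (matPoly (monicTuple A)).det := by
    refine (associated_unit_mul_left _ _ ?_).symm.trans
      ((Associated.of_eq h1).trans (associated_mul_unit_left _ _ ?_))
    · exact (Equiv.Perm.sign e).isUnit.map (Int.castRingHom ℂ[X])
    · exact (IsUnit.prod_univ_iff).2 hblockS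
  exact h2.roots_eq


/-! ### Operator `p`-norms of matrices and tuples -/

section

variable {ι κ : Type*} [Fintype ι] [Fintype κ]

/-- Standard basis vectors have norm one for every `p`; this makes the final constant independent of
`p`. -/
theorem norm_entry_le_opNorm [DecidableEq κ] (p : ℝ≥0∞) [Fact (1 ≤ p)] (M : Matrix ι κ ℂ)
    (i : ι) (j : κ) : ‖M i j‖ ≤ opNorm p M := by
  have h1 := (LinearMap.toContinuousLinearMap (Matrix.toLpLin p p M)).le_opNorm
    (PiLp.single p j 1)
  rw [PiLp.norm_single, norm_one, mul_one] at h1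
  refine le_trans ?_ h1
  have h2 := PiLp.norm_apply_le (Matrix.toLpLin p p M (PiLp.single p j 1)) i
  simpa [Matrix.toLpLin_apply] using h2

theorem norm_mulVec_le_opNorm [DecidableEq κ] (p : ℝ≥0∞) [Fact (1 ≤ p)] (M : Matrix ι κ ℂ)
    (x : κ → ℂ) : ‖WithLp.toLp p (M *ᵥ x)‖ ≤ opNorm p M * ‖WithLp.toLp p x‖ :=
  (LinearMap.toContinuousLinearMap (Matrix.toLpLin p p M)).le_opNorm (WithLp.toLp p x)

/-- Restricting a vector to some of its coordinates does not increase its `p`-norm. -/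
theorem norm_toLp_comp_le (p : ℝ≥0∞) [Fact (1 ≤ p)] {f : κ → ι} (hf : Function.Injective f)
    (x : ι → ℂ) : ‖WithLp.toLp p (x ∘ f)‖ ≤ ‖WithLp.toLp p x‖ := by
  rcases eq_or_ne p ∞ with rfl | hp
  · rw [PiLp.norm_eq_ciSup]
    exact Real.iSup_le (fun i => PiLp.norm_apply_le (WithLp.toLp ∞ x) (f i)) (norm_nonneg _)
  · have hp0 : 0 < p.toReal :=
      ENNReal.toReal_pos (zero_lt_one.trans_le (Fact.out : 1 ≤ p)).ne' hp
    rw [PiLp.norm_eq_sum hp0, PiLp.norm_eq_sum hp0]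
    refine Real.rpow_le_rpow (Finset.sum_nonneg fun i _ => by positivity) ?_ (by positivity)
    have h1 := Finset.sum_map Finset.univ ⟨f, hf⟩ fun i => ‖x i‖ ^ p.toReal
    refine (le_of_eq ?_).trans ((h1.symm.le).trans
      (Finset.sum_le_univ_sum_of_nonneg fun i => by positivity))
    rfl

end

/-- A block row acts as the sum of its blocks applied to the coordinate blocks of the vector, none
of which has larger norm than the vector. -/
theorem tupleNorm_le_sum {k n : ℕ} (p : ℝ≥0∞) [Fact (1 ≤ p)]
    (A : Fin k → Matrix (Fin n) (Fin n) ℂ) : tupleNorm p A ≤ ∑ i, opNorm p (A i) := by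
  refine ContinuousLinearMap.opNorm_le_bound _
    (Finset.sum_nonneg fun i _ => norm_nonneg _) fun x => ?_
  have h1 : (Matrix.of fun (a : Fin n) (c : Fin k × Fin n) => A c.1 a c.2) *ᵥ WithLp.ofLp x =
      ∑ i, A i *ᵥ (WithLp.ofLp x ∘ Prod.mk i) := by
    ext a
    simp [Matrix.mulVec, dotProduct, Fintype.sum_prod_type]
  rw [LinearMap.coe_toContinuousLinearMap', Matrix.toLpLin_apply, h1, WithLp.toLp_sum,
    Finset.sum_mul]
  refine norm_sum_le_of_le _ fun i _ => (norm_mulVec_le_opNorm p (A i) _).trans ?_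
  gcongr
  · exact norm_nonneg _
  · exact norm_toLp_comp_le p (Prod.mk_right_injective i) (WithLp.ofLp x)


/-! ### Assembling the estimate -/

/-- If all entries of `M` are at most `t`, then `|⟨x, M y⟩| ≤ (card ι)² t` for unit vectors. -/
theorem norm_inner_toEuclideanLin_le {ι : Type*} [Fintype ι] [DecidableEq ι] (M : Matrix ι ι ℂ)
    {t : ℝ} (hM : ∀ i j, ‖M i j‖ ≤ t) (x y : EuclideanSpace ℂ ι) (hx : ‖x‖ = 1) (hy : ‖y‖ = 1) :
    ‖inner ℂ x (Matrix.toEuclideanLin M y)‖ ≤ (Fintype.card ι : ℝ) ^ 2 * t := by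
  have hx' : ∀ i, ‖x i‖ ≤ 1 := fun i => (PiLp.norm_apply_le x i).trans hx.le
  have hy' : ∀ i, ‖y i‖ ≤ 1 := fun i => (PiLp.norm_apply_le y i).trans hy.le
  rw [PiLp.inner_apply]
  have h1 : ∀ i j, ‖M i j * y j‖ ≤ t := fun i j => by
    rw [norm_mul]
    exact (mul_le_of_le_one_right (norm_nonneg _) (hy' j)).trans (hM i j)
  have h2 : ∀ i, ‖inner ℂ (x i) (Matrix.toEuclideanLin M y i)‖ ≤ Fintype.card ι * t := fun i => by
    refine (norm_inner_le_norm _ _).trans ((mul_le_of_le_one_left (norm_nonneg _) (hx' i)).trans ?_)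
    refine (norm_sum_le_of_le Finset.univ fun j _ => h1 i j).trans (le_of_eq ?_)
    simp
  refine (norm_sum_le_of_le Finset.univ fun i _ => h2 i).trans (le_of_eq ?_)
  simp
  ring

/-- The matching distance of two families is at most that of any rearrangements of them. -/
theorem matchingDist_le {N : ℕ} (hN : 0 < N) {α β a b : Fin N → ℂ} {r : ℝ}
    (hα : Finset.univ.val.map α = Finset.univ.val.map a)
    (hβ : Finset.univ.val.map β = Finset.univ.val.map b) (h : ∀ i, ‖a i - b i‖ ≤ r) :
    matchingDist α β ≤ r := by
  obtain ⟨σ, hσ⟩ := exists_perm_of_map_univ_eq hα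
  obtain ⟨τ, hτ⟩ := exists_perm_of_map_univ_eq hβ
  have : Nonempty (Fin N) := ⟨⟨0, hN⟩⟩
  -- The permutation passes from `α` to the arrangement `a`, and back from `b` to `β`.
  refine (ciInf_le (Set.finite_range _).bddBelow (σ.trans τ.symm)).trans (ciSup_le fun j => ?_)
  have h1 : β ((σ.trans τ.symm) j) = b (σ j) := by
    rw [← hτ, Equiv.trans_apply, Equiv.apply_symm_apply]
  rw [h1, ← hσ]
  exact h _

theorem monicTuple_sub_castSucc {m n : ℕ} (A B : Fin m → Matrix (Fin n) (Fin n) ℂ) (i : Fin m) :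
    (monicTuple A - monicTuple B) i.castSucc = A i - B i := by
  simp [monicTuple]

theorem monicTuple_sub_last {m n : ℕ} (A B : Fin m → Matrix (Fin n) (Fin n) ℂ) :
    (monicTuple A - monicTuple B) (Fin.last m) = 0 := by
  simp [monicTuple]

/-- The companion matrices differ only in the last block row, whose entries are entries of the
tuple. -/
theorem norm_companion_sub_le {m n : ℕ} (p : ℝ≥0∞) [Fact (1 ≤ p)]
    (A B : Fin m → Matrix (Fin n) (Fin n) ℂ) (r c : Fin m × Fin n) :
    ‖(companion B - companion A) r c‖ ≤ tupleNorm p (monicTuple A - monicTuple B) := by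
  have h0 : 0 ≤ tupleNorm p (monicTuple A - monicTuple B) := norm_nonneg _
  by_cases hr : (r.1 : ℕ) + 1 = m
  · have h1 : (companion B - companion A) r c = A c.1 r.2 c.2 - B c.1 r.2 c.2 := by
      simp [companion, hr]
      ring
    have h2 := norm_entry_le_opNorm p (Matrix.of fun (a : Fin n) (c : Fin (m + 1) × Fin n) =>
      (monicTuple A - monicTuple B) c.1 a c.2) r.2 (c.1.castSucc, c.2)
    rw [Matrix.of_apply, monicTuple_sub_castSucc, Matrix.sub_apply] at h2
    rw [h1]
    exact h2
  · simpa [companion, hr] using h0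

theorem specDist_le {m n : ℕ} (hm : 0 < m) (hn : 0 < n) (p : ℝ≥0∞) [Fact (1 ≤ p)]
    (A B : Fin m → Matrix (Fin n) (Fin n) ℂ) (hA : (companion A).IsHermitian) :
    specDist A B ≤ ((m * n : ℕ) + 1) * (((m * n : ℕ) : ℝ) ^ 2 *
      tupleNorm p (monicTuple A - monicTuple B)) := by
  obtain ⟨m, rfl⟩ := Nat.exists_eq_succ_of_ne_zero hm.ne'
  have hcard : Fintype.card (Fin (m + 1) × Fin n) = (m + 1) * n := by simp
  obtain ⟨a, t, ha, ht, hat⟩ := exists_matching_of_isSymmetric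
    (finrank_euclideanSpace.trans hcard)
    (Matrix.isSymmetric_toEuclideanLin_iff.2 hA) (Matrix.toEuclideanLin (companion B))
    (ε := (((m + 1) * n : ℕ) : ℝ) ^ 2 * tupleNorm p (monicTuple A - monicTuple B)) (by
      intro x y hx hy
      rw [← map_sub, ← hcard]
      exact norm_inner_toEuclideanLin_le _ (norm_companion_sub_le p A B) x y hx hy)
  have hchar : ∀ M : Matrix (Fin (m + 1) × Fin n) (Fin (m + 1) × Fin n) ℂ,
      (Matrix.toEuclideanLin M).charpoly = M.charpoly := fun M => by
    rw [Matrix.toEuclideanLin, Matrix.toLpLin_eq_toLin, Matrix.charpoly_toLin]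
  rw [hchar, roots_charpoly_companion, ← map_eigs] at ha ht
  exact matchingDist_le (Nat.mul_pos hm hn) ha ht hat

end MatPoly

theorem mainTheorem6 :
    ∃ γ : ℕ → ℕ → ℝ, ∀ (m n : ℕ), 0 < m → 0 < n →
      ∀ (p : ℝ≥0∞) [Fact (1 ≤ p)] (A B : Fin m → Matrix (Fin n) (Fin n) ℂ),
        (MatPoly.companion A).IsHermitian →
          MatPoly.specDist A B ≤
              (γ m n + 2) * MatPoly.tupleNorm p (MatPoly.monicTuple A - MatPoly.monicTuple B) ∧
            (γ m n + 2) * MatPoly.tupleNorm p (MatPoly.monicTuple A - MatPoly.monicTuple B) ≤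
              (γ m n + 2) * ∑ i : Fin m, MatPoly.opNorm p (A i - B i) := by
  -- `N + 1` comes from the matching and `N ^ 2` from the passage from entries to the sesquilinear
  -- form; the summand `2` is slack.
  refine ⟨fun m n => ((m * n : ℕ) + 1) * ((m * n : ℕ) : ℝ) ^ 2, fun m n hm hn p _ A B hA => ?_⟩
  have h0 : 0 ≤ MatPoly.tupleNorm p (MatPoly.monicTuple A - MatPoly.monicTuple B) := norm_nonneg _
  refine ⟨(MatPoly.specDist_le hm hn p A B hA).trans ?_, ?_⟩
  · rw [← mul_assoc]
    gcongr
    linarith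
  · gcongr
    refine (MatPoly.tupleNorm_le_sum p _).trans (le_of_eq ?_)
    -- The leading coefficients cancel, so the last block adds nothing to the sum.
    rw [Fin.sum_univ_castSucc, MatPoly.monicTuple_sub_last]
    simp only [MatPoly.monicTuple_sub_castSucc]
    simp [MatPoly.opNorm]
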